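/- Let $d\ge 1$ and let $P=(p(k,i;l,j))$ be a stochastic matrix indexed by $\mathbb{F}=\mathbb{Z}_+\times\{1,\dots,d\}$. Suppose that $P$ is irreducible and block-monotone with block size $d$, i.e. $\sum_{m\ge l}p(k,i;m,j)\le\sum_{m\ge l}p(k+1,i;m,j)$ for all $k,l\in\mathbb{Z}_+$ and $i,j\in\{1,\dots,d\}$. Suppose also that $P$ is positive recurrent, and let $\pi$ be its stationary probability vector. Assume that there are $\gamma\in(0,1)$, $b\in(0,\infty)$ and a real column vector $v=(v(k,i))_{(k,i)\in\mathbb{F}}$ with $v(k,i)\ge 1$ and $v(k,i)\le v(k+1,i)$ for all $(k,i)\in\mathbb{F}$, such that $$\sum_{(l,j)\in\mathbb{F}}p(k,i;l,j)\,v(l,j)\le\gamma\,v(k,i)+b\,\mathbf 1_{\{k=0\}},\qquad (k,i)\in\mathbb{F}.$$ For $n\ge 1$ let $P_n=(p_n(k,i;l,j))$ be the last-column-block-augmented truncation of $P$, i.e. the stochastic matrix on $\mathbb{F}$ with $p_n(k,i;l,j)=p(k,i;l,j)$ for $l\le n-1$, $p_n(k,i;n,j)=\sum_{l\ge n}p(k,i;l,j)$,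 and $p_n(k,i;l,j)=0$ for $l>n$. Let $\pi_n$ be a stationary probability vector of $P_n$, and write $\|x\|=\sum_{(k,i)\in\mathbb{F}}|x(k,i)|$. Then for all integers $n\ge 1$ and $m\ge 1$, $$\|\pi_n-\pi\|\le 4\gamma^m\frac{b}{1-\gamma}+2m\sum_{i=1}^d\pi_n(n,i),$$ and $$\|\pi_n-\pi\|\le\frac{b}{1-\gamma}\Bigl(4\gamma^m+2m\sum_{i=1}^d\frac1{v(n,i)}\Bigr).$$ -/

import Mathlib

namespace BlockMonotone

/-- The state space `ℤ₊ × {1, …, d}`: a level `k` and a phase `i`. -/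
abbrev State (d : ℕ) : Type := ℕ × Fin d

/-- A (possibly infinite) matrix is stochastic: nonnegative entries, every row sums to one. -/
structure IsStochastic {S : Type*} (P : Matrix S S ℝ) : Prop where
  nonneg : ∀ x y, 0 ≤ P x y
  row_sum : ∀ x, HasSum (fun y => P x y) 1

/-- `μ` is a stationary probability vector of `P`: `μ ≥ 0`, `μ e = 1` and `μ P = μ`. -/
structure IsStationary {S : Type*} (P : Matrix S S ℝ) (μ : S → ℝ) : Prop where
  nonneg : ∀ x, 0 ≤ μ x
  sum_eq_one : HasSum μ 1
  invariant : ∀ y, HasSum (fun x => μ x * P x y) (μ y)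

/-- The tail sum `∑_{m ≥ l} p(k, i; m, j)`, where `x = (k, i)`. -/
noncomputable def tailSum {d : ℕ} (P : Matrix (State d) (State d) ℝ)
    (x : State d) (l : ℕ) (j : Fin d) : ℝ :=
  ∑' m : ℕ, P x (l + m, j)

/-- Block-monotonicity with block size `d`: `P` is stochastic and its tail sums are
nondecreasing in the level of the row, for all phases `i`, `j`. -/
structure IsBlockMonotone {d : ℕ} (P : Matrix (State d) (State d) ℝ) : Prop where
  stochastic : IsStochastic P
  tail_mono : ∀ (k l : ℕ) (i j : Fin d), tailSum P (k, i) l j ≤ tailSum P (k + 1, i) l j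

/-- A column vector is block-increasing: it is nondecreasing in the level, for each phase. -/
def IsBlockIncreasing {d : ℕ} (f : State d → ℝ) : Prop :=
  ∀ (k : ℕ) (i : Fin d), f (k, i) ≤ f (k + 1, i)

/-- The indicator `1_K` of the set of states of level at most `K`. -/
def levelIndicator {d : ℕ} (K : ℕ) (x : State d) : ℝ :=
  if x.1 ≤ K then 1 else 0

/-- The geometric drift condition `P v ≤ γ v + b 1_0`; every entry of `P v` is a convergent
series. -/
def GeometricDrift {d : ℕ} (P : Matrix (State d) (State d) ℝ) (v : State d → ℝ)
    (γ b : ℝ) : Prop :=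
  ∀ x, Summable (fun y => P x y * v y) ∧
    ∑' y, P x y * v y ≤ γ * v x + b * levelIndicator 0 x

/-- The last-column-block-augmented first-`n`-block-column truncation of `P`. -/
noncomputable def lastColumnTruncation {d : ℕ} (P : Matrix (State d) (State d) ℝ) (n : ℕ) :
    Matrix (State d) (State d) ℝ :=
  Matrix.of fun x y =>
    if y.1 < n then P x y
    else if y.1 = n then tailSum P x n y.2
    else 0

/-- The total variation norm `∑_x |μ x|` (without a factor `1/2`). -/
noncomputable def tvNorm {S : Type*} (μ : S → ℝ) : ℝ :=
  ∑' x, |μ x|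

end BlockMonotone

namespace BlockMonotone

/-! Write Q for the truncation and ν for its stationary vector, and let s be the sign of ν - π, so
that the distance is ν(s) - π(s) = ν(Q^m s) - π(P^m s). Both terms are compared with chains
restarted at level 0 with the phase kept.

Block-monotonicity orders two chains that start in the same phase at different levels. Once the
upper one is at level 0 they coincide, and the drift makes the chance of not having merged by time m
at most γ^m v. Since v has stationary mean at most b/(1-γ), each restart costs 2γ^m b/(1-γ)
(`expect_sub_iterate_step_le`). The coupling is never built: `step_sub_le` is its dual form on
functions.

The restarted chains run under Q and P differ by at most twice the expected number of visits to
level n, which increases with the starting level and has ν-mean m ∑ ν(n,i)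
(`exists_iterate_step_sub_le`). Finally the phase is an autonomous irreducible chain, unaffected by
truncation, so ν and π have the same phase marginal (`expect_phase_eq`) and the restarted P-terms
cancel. -/

/-- A probability vector: nonnegative with total mass one. -/
structure IsProbVec {S : Type*} (μ : S → ℝ) : Prop where
  nonneg : ∀ x, 0 ≤ μ x
  sum_eq_one : HasSum μ 1

/-- The integral `∑ μ(x) f(x)` of a function against a vector. -/
noncomputable def expect {S : Type*} (μ f : S → ℝ) : ℝ :=
  ∑' x, μ x * f x

/-- The action `f ↦ P f` of a transition matrix on functions. -/
noncomputable def step {S : Type*} (P : Matrix S S ℝ) (f : S → ℝ) (x : S) : ℝ :=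
  expect (P x) f

/-- A bounded real function. -/
def IsBdd {S : Type*} (f : S → ℝ) : Prop :=
  ∃ C, ∀ x, |f x| ≤ C

/-! ### Expectations of bounded functions and stationarity. -/

section General

variable {S : Type*} {μ f g : S → ℝ} {P : Matrix S S ℝ}

theorem IsStochastic.row (hP : IsStochastic P) (x : S) : IsProbVec (P x) :=
  ⟨hP.nonneg x, hP.row_sum x⟩

theorem IsStationary.isProbVec (hμ : IsStationary P μ) : IsProbVec μ :=
  ⟨hμ.nonneg, hμ.sum_eq_one⟩

theorem IsBdd.add (hf : IsBdd f) (hg : IsBdd g) : IsBdd (fun x => f x + g x) := by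
  obtain ⟨C, hC⟩ := hf
  obtain ⟨D, hD⟩ := hg
  exact ⟨C + D, fun x => (abs_add_le _ _).trans (add_le_add (hC x) (hD x))⟩

theorem IsBdd.neg (hf : IsBdd f) : IsBdd (fun x => -f x) := by
  obtain ⟨C, hC⟩ := hf
  exact ⟨C, fun x => by simpa using hC x⟩

theorem IsBdd.sub (hf : IsBdd f) (hg : IsBdd g) : IsBdd (fun x => f x - g x) := by
  simpa only [sub_eq_add_neg] using hf.add hg.neg

theorem IsBdd.const_mul (c : ℝ) (hf : IsBdd f) : IsBdd (fun x => c * f x) := by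
  obtain ⟨C, hC⟩ := hf
  exact ⟨|c| * C, fun x => by
    rw [abs_mul]; exact mul_le_mul_of_nonneg_left (hC x) (abs_nonneg c)⟩

theorem IsBdd.comp {T : Type*} (hf : IsBdd f) (φ : T → S) : IsBdd (fun x => f (φ x)) := by
  obtain ⟨C, hC⟩ := hf
  exact ⟨C, fun x => hC (φ x)⟩

theorem isBdd_of_mem_Icc {a b : ℝ} (ha : ∀ x, a ≤ f x) (hb : ∀ x, f x ≤ b) : IsBdd f :=
  ⟨max |a| |b|, fun x => abs_le_max_abs_abs (ha x) (hb x)⟩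

theorem IsProbVec.summable_mul (hμ : IsProbVec μ) (hf : IsBdd f) :
    Summable (fun x => μ x * f x) := by
  obtain ⟨C, hC⟩ := hf
  refine Summable.of_norm_bounded (hμ.sum_eq_one.summable.mul_right C) fun x => ?_
  rw [Real.norm_eq_abs, abs_mul, abs_of_nonneg (hμ.nonneg x)]
  exact mul_le_mul_of_nonneg_left (hC x) (hμ.nonneg x)

theorem expect_mono_of_summable (hμ : ∀ x, 0 ≤ μ x) (hf : Summable (fun x => μ x * f x))
    (hg : Summable (fun x => μ x * g x)) (h : ∀ x, f x ≤ g x) : expect μ f ≤ expect μ g :=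
  hf.tsum_le_tsum (fun x => mul_le_mul_of_nonneg_left (h x) (hμ x)) hg

theorem IsProbVec.expect_mono (hμ : IsProbVec μ) (hf : IsBdd f) (hg : IsBdd g)
    (h : ∀ x, f x ≤ g x) : expect μ f ≤ expect μ g :=
  expect_mono_of_summable hμ.nonneg (hμ.summable_mul hf) (hμ.summable_mul hg) h

theorem IsProbVec.expect_const (hμ : IsProbVec μ) (c : ℝ) : expect μ (fun _ => c) = c := by
  simp [expect, tsum_mul_right, hμ.sum_eq_one.tsum_eq]

theorem expect_neg (μ f : S → ℝ) : expect μ (fun x => -f x) = -expect μ f := by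
  simp [expect, tsum_neg]

theorem expect_const_mul (μ f : S → ℝ) (c : ℝ) :
    expect μ (fun x => c * f x) = c * expect μ f := by
  simp only [expect, ← tsum_mul_left]
  exact tsum_congr fun x => by ring

theorem IsProbVec.expect_add (hμ : IsProbVec μ) (hf : IsBdd f) (hg : IsBdd g) :
    expect μ (fun x => f x + g x) = expect μ f + expect μ g := by
  simp only [expect, mul_add]
  exact (hμ.summable_mul hf).tsum_add (hμ.summable_mul hg)

theorem IsProbVec.expect_sub (hμ : IsProbVec μ) (hf : IsBdd f) (hg : IsBdd g) :
    expect μ (fun x => f x - g x) = expect μ f - expect μ g := by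
  simp only [expect, mul_sub]
  exact (hμ.summable_mul hf).tsum_sub (hμ.summable_mul hg)

theorem IsProbVec.abs_expect_le (hμ : IsProbVec μ) {C : ℝ} (hf : ∀ x, |f x| ≤ C) :
    |expect μ f| ≤ C := by
  have hb : IsBdd f := ⟨C, hf⟩
  rw [abs_le]
  constructor
  · rw [← hμ.expect_const (-C)]
    exact hμ.expect_mono ⟨|-C|, fun _ => le_rfl⟩ hb fun x => (abs_le.1 (hf x)).1
  · rw [← hμ.expect_const C]
    exact hμ.expect_mono hb ⟨|C|, fun _ => le_rfl⟩ fun x => (abs_le.1 (hf x)).2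

theorem IsStochastic.abs_step_le (hP : IsStochastic P) {C : ℝ} (hf : ∀ x, |f x| ≤ C) (x : S) :
    |step P f x| ≤ C :=
  (hP.row x).abs_expect_le hf

theorem IsStochastic.isBdd_step (hP : IsStochastic P) (hf : IsBdd f) : IsBdd (step P f) := by
  obtain ⟨C, hC⟩ := hf
  exact ⟨C, hP.abs_step_le hC⟩

theorem IsStochastic.abs_iterate_step_le (hP : IsStochastic P) {C : ℝ} (hf : ∀ x, |f x| ≤ C)
    (m : ℕ) (x : S) : |((step P)^[m] f) x| ≤ C := by
  induction m generalizing x with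
  | zero => exact hf x
  | succ m ih =>
    rw [Function.iterate_succ_apply']
    exact hP.abs_step_le ih x

theorem iterate_step_neg (P : Matrix S S ℝ) (f : S → ℝ) (m : ℕ) :
    (step P)^[m] (fun x => -f x) = fun x => -((step P)^[m] f) x := by
  induction m with
  | zero => rfl
  | succ m ih =>
    rw [Function.iterate_succ_apply', Function.iterate_succ_apply', ih]
    exact funext fun x => expect_neg _ _

/-- Fubini: the double series converges absolutely because f is bounded and the weights μ(x) P(x,y)
have total mass one. -/
theorem IsStationary.expect_step (hP : IsStochastic P) (hμ : IsStationary P μ) (hf : IsBdd f) :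
    expect μ (step P f) = expect μ f := by
  obtain ⟨C, hC⟩ := hf
  have hbase : Summable (fun p : S × S => μ p.1 * P p.1 p.2) := by
    refine (summable_prod_of_nonneg fun p : S × S =>
      mul_nonneg (hμ.nonneg p.1) (hP.nonneg p.1 p.2)).2
      ⟨fun x => (hP.row_sum x).summable.mul_left (μ x), ?_⟩
    refine hμ.sum_eq_one.summable.congr fun x => ?_
    change μ x = ∑' y, μ x * P x y
    rw [tsum_mul_left, (hP.row_sum x).tsum_eq, mul_one]
  have hsum : Summable (fun p : S × S => μ p.1 * P p.1 p.2 * f p.2) := by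
    refine Summable.of_norm_bounded (hbase.mul_right C) fun p => ?_
    have h0 : 0 ≤ μ p.1 * P p.1 p.2 := mul_nonneg (hμ.nonneg _) (hP.nonneg _ _)
    rw [Real.norm_eq_abs, abs_mul, abs_of_nonneg h0]
    exact mul_le_mul_of_nonneg_left (hC _) h0
  calc expect μ (step P f) = ∑' x, ∑' y, μ x * P x y * f y := by
        refine tsum_congr fun x => ?_
        rw [step, expect, ← tsum_mul_left]
        exact tsum_congr fun y => by ring
    _ = ∑' y, ∑' x, μ x * P x y * f y :=
        (Summable.tsum_comm (f := fun x y => μ x * P x y * f y) hsum).symm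
    _ = expect μ f := by
        refine tsum_congr fun y => ?_
        rw [tsum_mul_right, (hμ.invariant y).tsum_eq]

theorem IsStationary.expect_iterate_step (hP : IsStochastic P) (hμ : IsStationary P μ)
    (hf : IsBdd f) (m : ℕ) : expect μ ((step P)^[m] f) = expect μ f := by
  induction m with
  | zero => rfl
  | succ m ih =>
    obtain ⟨C, hC⟩ := hf
    rw [Function.iterate_succ_apply',
      hμ.expect_step hP ⟨C, hP.abs_iterate_step_le hC m⟩, ih]

/-- The total variation distance is attained on the sign function. -/
theorem tvNorm_sub_eq {ν : S → ℝ} (hμ : IsProbVec μ) (hν : IsProbVec ν) :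
    ∃ s : S → ℝ, (∀ x, |s x| ≤ 1) ∧ tvNorm (μ - ν) = expect μ s - expect ν s := by
  let s : S → ℝ := fun x => if 0 ≤ μ x - ν x then 1 else -1
  have hs : ∀ x, |s x| ≤ 1 := fun x => by
    dsimp only [s]; split_ifs <;> simp
  refine ⟨s, hs, ?_⟩
  rw [expect, expect, ← (hμ.summable_mul ⟨1, hs⟩).tsum_sub (hν.summable_mul ⟨1, hs⟩)]
  refine tsum_congr fun x => ?_
  dsimp only [s]
  split_ifs with h
  · rw [Pi.sub_apply, abs_of_nonneg h]; ring
  · rw [Pi.sub_apply, abs_of_neg (not_le.1 h)]; ring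

end General

open Filter Topology

/-- The operator `f ↦ P f` maps bounded block-increasing functions to block-increasing ones. -/
def PreservesBlockIncreasing {d : ℕ} (P : Matrix (State d) (State d) ℝ) : Prop :=
  ∀ f : State d → ℝ, IsBdd f → IsBlockIncreasing f → IsBlockIncreasing (step P f)

/-- The map collapsing all levels above `n` to level `n`. -/
def capLevel {d : ℕ} (n : ℕ) (x : State d) : State d :=
  (min x.1 n, x.2)

/-! ### Sums over levels and phases; summation by parts. -/

section Sums

theorem hasSum_state {d : ℕ} {F : State d → ℝ} {a : Fin d → ℝ}
    (h : ∀ j, HasSum (fun l => F (l, j)) (a j)) : HasSum F (∑ j, a j) := by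
  have hj : ∀ j ∈ Finset.univ,
      HasSum (fun y : State d => if y.2 = j then F y else 0) (a j) := by
    intro j _
    have hinj : Function.Injective (fun l : ℕ => ((l, j) : State d)) :=
      fun l l' hl => (Prod.ext_iff.1 hl).1
    refine (hinj.hasSum_iff ?_).1 (by simpa [Function.comp_def] using h j)
    rintro ⟨l, i⟩ hx
    by_cases hi : i = j
    · subst hi; exact absurd ⟨l, rfl⟩ hx
    · simp [hi]
  simpa using hasSum_sum hj

theorem summable_phase {d : ℕ} {F : State d → ℝ} (hF : Summable F) (j : Fin d) :
    Summable (fun l : ℕ => F (l, j)) :=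
  hF.comp_injective fun _ _ hl => (Prod.ext_iff.1 hl).1

theorem tsum_state {d : ℕ} {F : State d → ℝ} (hF : Summable F) :
    ∑' y, F y = ∑ j, ∑' l, F (l, j) :=
  (hasSum_state fun j => (summable_phase hF j).hasSum).tsum_eq

theorem summable_mul_of_abs_le {a f : ℕ → ℝ} (ha : Summable a) {C : ℝ} (hC : ∀ l, |f l| ≤ C) :
    Summable (fun l => a l * f l) := by
  refine Summable.of_norm_bounded (ha.abs.mul_right C) fun l => ?_
  rw [Real.norm_eq_abs, abs_mul]
  exact mul_le_mul_of_nonneg_left (hC l) (abs_nonneg _)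

/-- Summation by parts: a signed sequence of total mass zero with nonnegative tails integrates
bounded monotone functions to nonnegative values. -/
theorem tsum_mul_nonneg_of_tail_nonneg {δ f : ℕ → ℝ} (hδ : Summable δ)
    (htail : ∀ l, 0 ≤ ∑' m, δ (m + l)) (hzero : ∑' m, δ m = 0) (hf : Monotone f) {C : ℝ}
    (hC : ∀ l, |f l| ≤ C) : 0 ≤ ∑' l, δ l * f l := by
  -- Abel summation with the boundary term kept; the term vanishes in the limit because tails tend
  -- to 0 and f is bounded.
  have hpart : ∀ N, 0 ≤ (∑ l ∈ Finset.range N, δ l * f l) + (∑' m, δ (m + N)) * f N := by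
    intro N
    induction N with
    | zero => simp [hzero]
    | succ N ih =>
      have hsplit : ∑' m, δ (m + N) = δ N + ∑' m, δ (m + (N + 1)) := by
        rw [((summable_nat_add_iff N).2 hδ).tsum_eq_zero_add]
        simp [add_assoc, add_comm 1 N]
      rw [hsplit] at ih
      rw [Finset.sum_range_succ]
      nlinarith [mul_le_mul_of_nonneg_left (hf N.le_succ) (htail (N + 1))]
  have htend : Tendsto (fun N => (∑' m, δ (m + N)) * f N) atTop (𝓝 0) := by
    have h0 := (tendsto_sum_nat_add δ).abs.mul_const C
    rw [abs_zero, zero_mul] at h0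
    refine squeeze_zero_norm (fun N => ?_) h0
    rw [Real.norm_eq_abs, abs_mul]
    exact mul_le_mul_of_nonneg_left (hC N) (abs_nonneg _)
  have hlim := (summable_mul_of_abs_le hδ hC).hasSum.tendsto_sum_nat.add htend
  rw [add_zero] at hlim
  exact ge_of_tendsto' hlim hpart

end Sums

/-! ### Monotonicity and drift of P and of its truncation. -/

section Kernels

variable {d : ℕ} {P : Matrix (State d) (State d) ℝ}

theorem IsBlockIncreasing.monotone {f : State d → ℝ} (hf : IsBlockIncreasing f) (i : Fin d) :
    Monotone (fun k => f (k, i)) :=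
  monotone_nat_of_le_succ fun k => hf k i

/-- In a block-monotone matrix the total mass sent to a phase does not depend on the level. -/
theorem IsBlockMonotone.tailSum_zero_eq (hP : IsBlockMonotone P) (k : ℕ) (i j : Fin d) :
    tailSum P (k, i) 0 j = tailSum P (k + 1, i) 0 j := by
  have htot : ∀ x, ∑ j, tailSum P x 0 j = 1 := fun x => by
    rw [← (hP.stochastic.row_sum x).tsum_eq, tsum_state (hP.stochastic.row_sum x).summable]
    simp [tailSum]
  -- The tails at 0 are ordered phase by phase, while both totals equal one.
  exact (Finset.sum_eq_sum_iff_of_le fun j _ => hP.tail_mono k 0 i j).1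
    ((htot _).trans (htot _).symm) j (Finset.mem_univ j)

theorem IsBlockMonotone.preservesBlockIncreasing (hP : IsBlockMonotone P) :
    PreservesBlockIncreasing P := by
  rintro f ⟨C, hC⟩ hf k i
  have hs : ∀ k : ℕ, Summable (fun y => P (k, i) y * f y) := fun k =>
    (hP.stochastic.row (k, i)).summable_mul ⟨C, hC⟩
  have hr : ∀ (k : ℕ) (j : Fin d), Summable (fun l : ℕ => P (k, i) (l, j)) := fun k j =>
    summable_phase (hP.stochastic.row_sum (k, i)).summable j
  simp only [step, expect]
  rw [tsum_state (hs k), tsum_state (hs (k + 1))]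
  refine Finset.sum_le_sum fun j _ => ?_
  rw [← sub_nonneg, ← (summable_phase (hs (k + 1)) j).tsum_sub (summable_phase (hs k) j)]
  have key : ∀ l, ∑' m, (P (k + 1, i) (m + l, j) - P (k, i) (m + l, j)) =
      tailSum P (k + 1, i) l j - tailSum P (k, i) l j := fun l => by
    rw [Summable.tsum_sub ((summable_nat_add_iff l).2 (hr (k + 1) j))
      ((summable_nat_add_iff l).2 (hr k j))]
    simp only [tailSum, add_comm l]
  have := tsum_mul_nonneg_of_tail_nonneg ((hr (k + 1) j).sub (hr k j))
    (fun l => by rw [key l]; exact sub_nonneg.2 (hP.tail_mono k l i j))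
    (by simpa [hP.tailSum_zero_eq k i j] using key 0) (hf.monotone j) (fun l => hC (l, j))
  simpa only [sub_mul] using this

theorem IsBlockIncreasing.comp_capLevel {f : State d → ℝ} (hf : IsBlockIncreasing f) (n : ℕ) :
    IsBlockIncreasing (fun x => f (capLevel n x)) := fun k i =>
  hf.monotone i (min_le_min_right n k.le_succ)

/-- Integrating against a row of the truncation amounts to integrating the capped function
against the corresponding row of the original matrix. -/
theorem exists_hasSum_lastColumnTruncation (hP : IsStochastic P) (n : ℕ) (f : State d → ℝ)
    (x : State d) : ∃ a, HasSum (fun y => lastColumnTruncation P n x y * f y) a ∧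
      HasSum (fun y => P x y * f (capLevel n y)) a := by
  refine ⟨∑ j, (tailSum P x n j * f (n, j) + ∑ l ∈ Finset.range n, P x (l, j) * f (l, j)),
    hasSum_state fun j => ?_, hasSum_state fun j => ?_⟩
  · have h := hasSum_sum_of_ne_finset_zero
      (f := fun l => lastColumnTruncation P n x (l, j) * f (l, j)) (s := Finset.range (n + 1))
      (L := SummationFilter.unconditional ℕ)
      fun l hl => by
        have hl : n < l := by simpa using hl
        simp [lastColumnTruncation, hl.not_gt, hl.ne']
    rw [Finset.sum_range_succ, add_comm] at h
    convert h using 2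
    · simp [lastColumnTruncation]
    · refine Finset.sum_congr rfl fun l hl => ?_
      simp [lastColumnTruncation, Finset.mem_range.1 hl]
  · have hr := summable_phase (hP.row_sum x).summable j
    have h : HasSum (fun l => P x (l + n, j) * f (capLevel n (l + n, j)))
        (tailSum P x n j * f (n, j)) := by
      have := (((summable_nat_add_iff n).2 hr).hasSum).mul_right (f (n, j))
      simpa [capLevel, tailSum, add_comm n] using this
    have h2 := (hasSum_nat_add_iff (f := fun l => P x (l, j) * f (capLevel n (l, j))) n).1 h
    rwa [Finset.sum_congr rfl fun l hl => by
      rw [capLevel, min_eq_left (Finset.mem_range.1 hl).le]] at h2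

theorem step_lastColumnTruncation (hP : IsStochastic P) (n : ℕ) (f : State d → ℝ) :
    step (lastColumnTruncation P n) f = step P (fun y => f (capLevel n y)) := by
  funext x
  obtain ⟨a, h1, h2⟩ := exists_hasSum_lastColumnTruncation hP n f x
  exact h1.tsum_eq.trans h2.tsum_eq.symm

theorem IsStochastic.lastColumnTruncation (hP : IsStochastic P) (n : ℕ) :
    IsStochastic (lastColumnTruncation P n) := by
  refine ⟨fun x y => ?_, fun x => ?_⟩
  · simp only [BlockMonotone.lastColumnTruncation, Matrix.of_apply]
    split_ifs
    · exact hP.nonneg _ _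
    · exact tsum_nonneg fun m => hP.nonneg _ _
    · exact le_rfl
  · obtain ⟨a, h1, h2⟩ := exists_hasSum_lastColumnTruncation hP n (fun _ => 1) x
    simp only [mul_one] at h1 h2
    rwa [(hP.row_sum x).unique h2]

theorem IsBlockMonotone.preservesBlockIncreasing_lastColumnTruncation (hP : IsBlockMonotone P)
    (n : ℕ) : PreservesBlockIncreasing (lastColumnTruncation P n) := fun f hb hf => by
  rw [step_lastColumnTruncation hP.stochastic]
  exact hP.preservesBlockIncreasing _ (hb.comp _) (hf.comp_capLevel n)

/-- Capping the level can only lower a block-increasing v, so the drift inequality survives. -/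
theorem GeometricDrift.lastColumnTruncation (hP : IsStochastic P) {v : State d → ℝ} {γ b : ℝ}
    (hv : IsBlockIncreasing v) (hdrift : GeometricDrift P v γ b) (n : ℕ) :
    GeometricDrift (lastColumnTruncation P n) v γ b := by
  intro x
  obtain ⟨a, h1, h2⟩ := exists_hasSum_lastColumnTruncation hP n v x
  refine ⟨h1.summable, ?_⟩
  rw [h1.tsum_eq, ← h2.tsum_eq]
  exact (expect_mono_of_summable (hP.nonneg x) h2.summable (hdrift x).1
    fun y => hv.monotone y.2 (min_le_left y.1 n)).trans (hdrift x).2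

end Kernels

/-! ### Consequences of the drift condition. -/

section Drift

variable {d : ℕ} {P : Matrix (State d) (State d) ℝ} {μ v : State d → ℝ} {γ b : ℝ}

/-- Under the geometric drift condition the drift function integrates to at most `b / (1 - γ)`
against a stationary probability vector. -/
theorem IsStationary.expect_le_of_drift (hP : IsStochastic P) (hμ : IsStationary P μ)
    (hv : ∀ x, 0 ≤ v x) (hγ : γ ∈ Set.Ioo (0 : ℝ) 1) (hb : 0 ≤ b)
    (hdrift : GeometricDrift P v γ b) :
    Summable (fun x => μ x * v x) ∧ expect μ v ≤ b / (1 - γ) := by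
  have hγ1 : 0 < 1 - γ := sub_pos.2 hγ.2
  have hpv := hμ.isProbVec
  have h0 : ∀ x, 0 ≤ μ x * v x := fun x => mul_nonneg (hμ.nonneg x) (hv x)
  have hfin : ∀ F : Finset (State d), ∑ x ∈ F, μ x * v x ≤ b / (1 - γ) := by
    intro F
    -- Integrability of v is not yet known, so v is cut off at a height c that leaves it unchanged
    -- on F.
    set c := ∑ x ∈ F, v x
    have hc0 : 0 ≤ c := Finset.sum_nonneg fun x _ => hv x
    have hvc : ∀ x ∈ F, v x ≤ c := fun x hx => Finset.single_le_sum (fun y _ => hv y) hx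
    let w : State d → ℝ := fun x => min (v x) c
    let u : State d → ℝ := fun x => min (γ * v x) c
    have hγv : ∀ x, 0 ≤ γ * v x := fun x => mul_nonneg hγ.1.le (hv x)
    have hγv' : ∀ x, γ * v x ≤ v x := fun x => mul_le_of_le_one_left (hv x) hγ.2.le
    have hw : ∀ x, |w x| ≤ c := fun x =>
      abs_le.2 ⟨(neg_nonpos.2 hc0).trans (le_min (hv x) hc0), min_le_right _ _⟩
    have hwb : IsBdd w := ⟨c, hw⟩
    have hub : IsBdd u := isBdd_of_mem_Icc (fun x => le_min (hγv x) hc0) fun x => min_le_right _ _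
    have hbb : IsBdd (fun _ : State d => b) := ⟨|b|, fun _ => le_rfl⟩
    have hstep : ∀ x, step P w x ≤ u x + b := by
      intro x
      have h1 : step P w x ≤ γ * v x + b := by
        refine (expect_mono_of_summable (hP.nonneg x) ((hP.row x).summable_mul hwb)
          (hdrift x).1 fun y => min_le_left _ _).trans ((hdrift x).2.trans ?_)
        have : levelIndicator 0 x ≤ 1 := by unfold levelIndicator; split_ifs <;> norm_num
        linarith [mul_le_mul_of_nonneg_left this hb]
      have h2 : step P w x ≤ c + b := by linarith [(abs_le.1 (hP.abs_step_le hw x)).2]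
      dsimp only [u]
      rw [← min_add_add_right]
      exact le_min h1 h2
    have hle : expect μ w ≤ expect μ u + b := by
      rw [← hμ.expect_step hP hwb]
      refine (hpv.expect_mono (hP.isBdd_step hwb) (hub.add hbb) hstep).trans ?_
      rw [hpv.expect_add hub hbb, hpv.expect_const]
    have hwu : ∀ x, 0 ≤ μ x * (w x - u x) := fun x =>
      mul_nonneg (hμ.nonneg x) (sub_nonneg.2 (min_le_min_right c (hγv' x)))
    have hsum : ∑ x ∈ F, μ x * (w x - u x) ≤ b := by
      refine ((hpv.summable_mul (hwb.sub hub)).sum_le_tsum F fun x _ => hwu x).trans ?_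
      change expect μ (fun x => w x - u x) ≤ b
      rw [hpv.expect_sub hwb hub]
      linarith
    have heq : ∑ x ∈ F, μ x * (w x - u x) = (1 - γ) * ∑ x ∈ F, μ x * v x := by
      rw [Finset.mul_sum]
      refine Finset.sum_congr rfl fun x hx => ?_
      dsimp only [w, u]
      rw [min_eq_left (hvc x hx), min_eq_left ((hγv' x).trans (hvc x hx))]
      ring
    rw [le_div_iff₀ hγ1]
    linarith
  have hs : Summable (fun x => μ x * v x) := summable_of_sum_le h0 hfin
  exact ⟨hs, hs.tsum_le_of_sum_le hfin⟩

/-- One step of a monotone coupling, in dual form: if raising the level from `k` to `k'` increases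
`f` by at most `u(k', ·)`, then it increases `P f` by at most `(P u)(k', ·)`. -/
theorem PreservesBlockIncreasing.step_sub_le (hmono : PreservesBlockIncreasing P)
    (hP : IsStochastic P) {f u : State d → ℝ} (hf : IsBdd f)
    (hfu : ∀ (k k' : ℕ) (j : Fin d), k ≤ k' → f (k', j) - f (k, j) ≤ u (k', j))
    {k k' : ℕ} (hk : k ≤ k') (i : Fin d) (hu : Summable (fun y => P (k', i) y * u y)) :
    step P f (k', i) - step P f (k, i) ≤ expect (P (k', i)) u := by
  obtain ⟨C, hC⟩ := hf
  -- The function g is the least block-decreasing majorant of h and still lies below f. Flooring at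
  -- -C keeps g bounded, since u need not be.
  let h : State d → ℝ := fun y => max (f y - u y) (-C)
  let g : State d → ℝ := fun y => ⨆ t : ℕ, h (y.1 + t, y.2)
  have hle : ∀ y (t : ℕ), h (y.1 + t, y.2) ≤ f y := fun y t =>
    max_le (by linarith [hfu y.1 (y.1 + t) y.2 (Nat.le_add_right _ _)]) (abs_le.1 (hC y)).1
  have hbdd : ∀ y : State d, BddAbove (Set.range fun t : ℕ => h (y.1 + t, y.2)) := fun y =>
    ⟨f y, by rintro _ ⟨t, rfl⟩; exact hle y t⟩
  have hgf : ∀ y, g y ≤ f y := fun y => ciSup_le (hle y)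
  have hhg : ∀ y, h y ≤ g y := fun y => le_ciSup (hbdd y) 0
  have hgb : IsBdd g := isBdd_of_mem_Icc (fun y => (le_max_right _ _).trans (hhg y))
    fun y => (hgf y).trans (abs_le.1 (hC y)).2
  have hanti : IsBlockIncreasing (fun y => -g y) := fun k j => by
    refine neg_le_neg (ciSup_le fun t => ?_)
    have := le_ciSup (hbdd (k, j)) (t + 1)
    simpa [add_assoc, add_comm 1 t] using this
  have h1 : step P g (k', i) ≤ step P g (k, i) := by
    have := (hmono _ hgb.neg hanti).monotone i hk
    simp only [step, expect_neg] at this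
    exact neg_le_neg_iff.1 this
  have h2 : step P g (k, i) ≤ step P f (k, i) := (hP.row _).expect_mono hgb ⟨C, hC⟩ hgf
  have h3 : step P f (k', i) - expect (P (k', i)) u ≤ step P g (k', i) := by
    have hsf := (hP.row (k', i)).summable_mul ⟨C, hC⟩
    rw [step, expect, expect, ← hsf.tsum_sub hu]
    refine (hsf.sub hu).tsum_le_tsum (fun y => ?_) ((hP.row _).summable_mul hgb)
    rw [← mul_sub]
    exact mul_le_mul_of_nonneg_left ((le_max_left _ _).trans (hhg y)) (hP.nonneg _ _)
  linarith

/-- The value 0 at k' = 0 encodes that the coupled chains have merged. It lets the induction use the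
drift only at positive levels, where the term b is absent. -/
theorem PreservesBlockIncreasing.iterate_step_sub_le (hmono : PreservesBlockIncreasing P)
    (hP : IsStochastic P) (hv1 : ∀ x, 1 ≤ v x) (hγ : 0 ≤ γ) (hdrift : GeometricDrift P v γ b)
    {f : State d → ℝ} (hf : ∀ x, |f x| ≤ 1) (m : ℕ) (k k' : ℕ) (i : Fin d) (hk : k ≤ k') :
    ((step P)^[m] f) (k', i) - ((step P)^[m] f) (k, i) ≤
      if k' = 0 then 0 else 2 * γ ^ m * v (k', i) := by
  induction m generalizing k k' i with
  | zero =>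
    split_ifs with h
    · obtain rfl : k = k' := by omega
      exact (sub_self _).le
    · have h1 := (abs_le.1 (hf (k', i))).2
      have h2 := (abs_le.1 (hf (k, i))).1
      simp only [Function.iterate_zero, id, pow_zero, mul_one]
      linarith [hv1 (k', i)]
  | succ m ih =>
    split_ifs with h
    · obtain rfl : k = k' := by omega
      exact (sub_self _).le
    · rw [Function.iterate_succ_apply']
      have hc : 0 ≤ 2 * γ ^ m := by positivity
      have hv0 : ∀ x, 0 ≤ v x := fun x => zero_le_one.trans (hv1 x)
      let u : State d → ℝ := fun y => if y.1 = 0 then 0 else 2 * γ ^ m * v y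
      have hu0 : ∀ y, 0 ≤ u y := fun y => by
        dsimp only [u]; split_ifs; exacts [le_rfl, mul_nonneg hc (hv0 y)]
      have huv : ∀ y, u y ≤ 2 * γ ^ m * v y := fun y => by
        dsimp only [u]; split_ifs; exacts [mul_nonneg hc (hv0 y), le_rfl]
      have hsv : Summable (fun y => P (k', i) y * (2 * γ ^ m * v y)) :=
        ((hdrift (k', i)).1.mul_left (2 * γ ^ m)).congr fun y => by ring
      have hsu : Summable (fun y => P (k', i) y * u y) :=
        hsv.of_nonneg_of_le (fun y => mul_nonneg (hP.nonneg _ _) (hu0 y))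
          fun y => mul_le_mul_of_nonneg_left (huv y) (hP.nonneg _ _)
      have hd : expect (P (k', i)) v ≤ γ * v (k', i) := by
        simpa [levelIndicator, h, expect] using (hdrift (k', i)).2
      calc _ ≤ expect (P (k', i)) u :=
            hmono.step_sub_le hP ⟨1, hP.abs_iterate_step_le hf m⟩
              (fun k k' j hk => ih k k' j hk) hk i hsu
        _ ≤ expect (P (k', i)) (fun y => 2 * γ ^ m * v y) :=
            expect_mono_of_summable (hP.nonneg _) hsu hsv huv
        _ = 2 * γ ^ m * expect (P (k', i)) v := expect_const_mul _ _ _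
        _ ≤ 2 * γ ^ m * (γ * v (k', i)) := mul_le_mul_of_nonneg_left hd hc
        _ = 2 * γ ^ (m + 1) * v (k', i) := by ring

/-- Geometric convergence to stationarity of the chain started from level zero with the phase
distribution of the stationary vector. -/
theorem IsStationary.expect_sub_iterate_step_le (hP : IsStochastic P) (hμ : IsStationary P μ)
    (hmono : PreservesBlockIncreasing P) (hv1 : ∀ x, 1 ≤ v x) (hγ : γ ∈ Set.Ioo (0 : ℝ) 1)
    (hb : 0 ≤ b) (hdrift : GeometricDrift P v γ b) {f : State d → ℝ} (hf : ∀ x, |f x| ≤ 1)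
    (m : ℕ) : expect μ f - expect μ (fun x => ((step P)^[m] f) (0, x.2)) ≤
      2 * γ ^ m * (b / (1 - γ)) := by
  have hv0 : ∀ x, 0 ≤ v x := fun x => zero_le_one.trans (hv1 x)
  have hc : 0 ≤ 2 * γ ^ m := by have := hγ.1; positivity
  obtain ⟨hs, hle⟩ := hμ.expect_le_of_drift hP hv0 hγ hb hdrift
  have hgb : IsBdd ((step P)^[m] f) := ⟨1, hP.abs_iterate_step_le hf m⟩
  have hgb' := hgb.comp (fun x : State d => (0, x.2))
  rw [← hμ.expect_iterate_step hP ⟨1, hf⟩ m, ← hμ.isProbVec.expect_sub hgb hgb']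
  calc _ ≤ expect μ (fun y => 2 * γ ^ m * v y) := by
        refine expect_mono_of_summable hμ.nonneg (hμ.isProbVec.summable_mul (hgb.sub hgb'))
          ((hs.mul_left (2 * γ ^ m)).congr fun y => by ring) fun x => ?_
        refine (hmono.iterate_step_sub_le hP hv1 hγ.1.le hdrift hf m 0 x.1 x.2
          (Nat.zero_le _)).trans ?_
        split_ifs
        exacts [mul_nonneg hc (hv0 x), le_rfl]
    _ = 2 * γ ^ m * expect μ v := expect_const_mul _ _ _
    _ ≤ _ := mul_le_mul_of_nonneg_left hle hc

end Drift

/-! ### The phase process and its stationary law. -/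

section Phases

/-- A signed invariant vector of total mass zero of an irreducible finite stochastic matrix
vanishes; irreducibility is stated through closed sets of states. -/
theorem eq_zero_of_invariant_of_sum_eq_zero {ι : Type*} [Fintype ι] {ψ : ι → ι → ℝ}
    (hψ : ∀ i j, 0 ≤ ψ i j) (hrow : ∀ i, ∑ j, ψ i j = 1)
    (hirr : ∀ S : Set ι, S.Nonempty → (∀ i ∈ S, ∀ j, 0 < ψ i j → j ∈ S) → ∀ j, j ∈ S)
    {w : ι → ℝ} (hw : ∀ j, ∑ i, w i * ψ i j = w j) (hsum : ∑ i, w i = 0) : ∀ i, w i = 0 := by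
  -- The positive part is subinvariant and ψ preserves mass, so it is invariant and its support is
  -- closed.
  let u : ι → ℝ := fun i => max (w i) 0
  have hu0 : ∀ i, 0 ≤ u i := fun i => le_max_right _ _
  have hle : ∀ j, u j ≤ ∑ i, u i * ψ i j := fun j => by
    refine max_le ?_ (Finset.sum_nonneg fun i _ => mul_nonneg (hu0 i) (hψ i j))
    rw [← hw j]
    exact Finset.sum_le_sum fun i _ => mul_le_mul_of_nonneg_right (le_max_left _ _) (hψ i j)
  have htot : ∑ j, u j = ∑ j, ∑ i, u i * ψ i j := by
    rw [Finset.sum_comm]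
    exact Finset.sum_congr rfl fun i _ => by rw [← Finset.mul_sum, hrow, mul_one]
  have hinv : ∀ j, u j = ∑ i, u i * ψ i j := fun j =>
    (Finset.sum_eq_sum_iff_of_le fun j _ => hle j).1 htot j (Finset.mem_univ j)
  have hnonpos : ∀ i, w i ≤ 0 := by
    by_contra! hpos
    obtain ⟨i₀, hi₀⟩ := hpos
    have hall : ∀ j, 0 < w j := hirr {i | 0 < w i} ⟨i₀, hi₀⟩ fun i hi j hij => by
      have hterm : 0 < u i * ψ i j := mul_pos (lt_max_of_lt_left hi) hij
      have huj : 0 < u j := (hinv j).symm ▸ hterm.trans_le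
        (Finset.single_le_sum (fun i _ => mul_nonneg (hu0 i) (hψ i j)) (Finset.mem_univ i))
      simpa [u] using huj
    exact (Finset.sum_pos (fun j _ => hall j) ⟨i₀, Finset.mem_univ i₀⟩).ne' hsum
  exact fun i => (Finset.sum_eq_zero_iff_of_nonpos fun i _ => hnonpos i).1 hsum i
    (Finset.mem_univ i)

/-- The indicator of a phase. -/
def phaseIndicator {d : ℕ} (j : Fin d) (x : State d) : ℝ :=
  if x.2 = j then 1 else 0

theorem isBdd_phase {d : ℕ} (h : Fin d → ℝ) : IsBdd (fun x : State d => h x.2) :=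
  ⟨∑ j, |h j|, fun x => Finset.single_le_sum (fun j _ => abs_nonneg (h j)) (Finset.mem_univ x.2)⟩

theorem isBdd_phaseIndicator {d : ℕ} (j : Fin d) : IsBdd (phaseIndicator j) :=
  isBdd_phase fun i => if i = j then 1 else 0

variable {d : ℕ} {P : Matrix (State d) (State d) ℝ} {μ ν : State d → ℝ}

theorem IsProbVec.expect_phase (hμ : IsProbVec μ) (h : Fin d → ℝ) :
    expect μ (fun x => h x.2) = ∑ i, expect μ (phaseIndicator i) * h i := by
  simp only [expect, ← tsum_mul_right]
  rw [← Summable.tsum_finsetSum fun i _ => (hμ.summable_mul (isBdd_phaseIndicator i)).mul_right _]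
  exact tsum_congr fun x => by simp [phaseIndicator]

/-- A function of the phase alone is block-increasing, and so is its negative; hence its image is
constant in the level. -/
theorem PreservesBlockIncreasing.step_phase (hmono : PreservesBlockIncreasing P)
    (h : Fin d → ℝ) (k : ℕ) (i : Fin d) :
    step P (fun x => h x.2) (k, i) = step P (fun x => h x.2) (0, i) := by
  refine le_antisymm ?_ ((hmono _ (isBdd_phase h) fun _ _ => le_rfl).monotone i (Nat.zero_le k))
  have := (hmono _ (isBdd_phase h).neg fun _ _ => le_rfl).monotone i (Nat.zero_le k)
  simp only [step, expect_neg] at this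
  exact neg_le_neg_iff.1 this

theorem PreservesBlockIncreasing.step_phaseIndicator (hmono : PreservesBlockIncreasing P)
    (j : Fin d) (x : State d) : step P (phaseIndicator j) x = step P (phaseIndicator j) (0, x.2) :=
  hmono.step_phase (fun i => if i = j then 1 else 0) x.1 x.2

theorem IsStationary.phase_invariant (hP : IsStochastic P) (hmono : PreservesBlockIncreasing P)
    (hμ : IsStationary P μ) (j : Fin d) :
    ∑ i, expect μ (phaseIndicator i) * step P (phaseIndicator j) (0, i) =
      expect μ (phaseIndicator j) := by
  rw [← hμ.isProbVec.expect_phase fun i => step P (phaseIndicator j) (0, i),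
    ← hμ.expect_step hP (isBdd_phaseIndicator j)]
  exact congrArg (expect μ) (funext fun x => (hmono.step_phaseIndicator j x).symm)

theorem IsProbVec.sum_expect_phaseIndicator (hμ : IsProbVec μ) :
    ∑ i, expect μ (phaseIndicator i) = 1 := by
  simpa [hμ.expect_const] using (hμ.expect_phase fun _ => 1).symm

/-- The phase marginal of a stationary vector of a truncation agrees with that of the original
chain. -/
theorem expect_phase_eq (hBM : IsBlockMonotone P) (hirr : P.IsIrreducible)
    (hμ : IsStationary P μ) {n : ℕ} (hν : IsStationary (lastColumnTruncation P n) ν)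
    (h : Fin d → ℝ) : expect ν (fun x => h x.2) = expect μ (fun x => h x.2) := by
  have hP := hBM.stochastic
  have hmono := hBM.preservesBlockIncreasing
  have hstep : ∀ j, step (lastColumnTruncation P n) (phaseIndicator j) =
      step P (phaseIndicator j) := fun j => step_lastColumnTruncation hP n _
  have hpos : ∀ i j, 0 ≤ step P (phaseIndicator j) ((0, i) : State d) := fun i j =>
    tsum_nonneg fun y => mul_nonneg (hP.nonneg _ _) (by unfold phaseIndicator; split_ifs <;> simp)
  have hclosed : ∀ S : Set (Fin d), S.Nonempty →
      (∀ i ∈ S, ∀ j, 0 < step P (phaseIndicator j) (0, i) → j ∈ S) → ∀ j, j ∈ S := by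
    rintro S ⟨i, hi⟩ hS j
    let := P.toQuiver
    obtain ⟨p, -⟩ := hirr.connected ((0, i) : State d) (0, j)
    -- Each edge of a path in the full chain projects to a phase transition of positive probability.
    have hreach : ∀ {y : State d}, Quiver.Path ((0, i) : State d) y → y.2 ∈ S := by
      intro y q
      induction q with
      | nil => exact hi
      | @cons x y _ e ih =>
        refine hS x.2 ih y.2 ?_
        rw [← hmono.step_phaseIndicator y.2 x]
        have hle := ((hP.row x).summable_mul (isBdd_phaseIndicator y.2)).le_tsum y fun z _ =>
          mul_nonneg (hP.nonneg x z) (by unfold phaseIndicator; split_ifs <;> simp)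
        have he : P x y * phaseIndicator y.2 y = P x y := by simp [phaseIndicator]
        exact (he ▸ e.down).trans_le hle
    exact hreach p
  have hzero := eq_zero_of_invariant_of_sum_eq_zero
    (w := fun i => expect ν (phaseIndicator i) - expect μ (phaseIndicator i)) hpos
    (fun i => (hP.row ((0, i) : State d)).sum_expect_phaseIndicator) hclosed
    (fun j => by
      have h1 := hν.phase_invariant (hP.lastColumnTruncation n)
        (hBM.preservesBlockIncreasing_lastColumnTruncation n) j
      rw [hstep] at h1
      simp only [sub_mul, Finset.sum_sub_distrib, h1, hμ.phase_invariant hP hmono j])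
    (by rw [Finset.sum_sub_distrib, hν.isProbVec.sum_expect_phaseIndicator,
      hμ.isProbVec.sum_expect_phaseIndicator, sub_self])
  rw [hν.isProbVec.expect_phase, hμ.isProbVec.expect_phase]
  exact Finset.sum_congr rfl fun i _ => by rw [sub_eq_zero.1 (hzero i)]

end Phases

/-! ### The error made by truncating over m steps. -/

section Truncation

variable {d : ℕ} {P : Matrix (State d) (State d) ℝ}

/-- The indicator of the states of level exactly `n`. -/
def atLevel {d : ℕ} (n : ℕ) (x : State d) : ℝ :=
  if x.1 = n then 1 else 0

theorem isBdd_atLevel (n : ℕ) : IsBdd (atLevel (d := d) n) :=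
  isBdd_of_mem_Icc (a := 0) (b := 1) (fun x => by unfold atLevel; split_ifs <;> norm_num)
    fun x => by unfold atLevel; split_ifs <;> norm_num

theorem expect_atLevel (μ : State d → ℝ) (n : ℕ) : expect μ (atLevel n) = ∑ i, μ (n, i) := by
  refine (hasSum_state fun j => ?_).tsum_eq
  have h := hasSum_single (f := fun l => μ (l, j) * atLevel n (l, j)) n fun l hl => by
    simp [atLevel, hl]
  simpa [atLevel] using h

/-- The two integrands differ only on a jump to level n or above, which the truncation sends to
level n exactly. -/
theorem step_truncation_sub_le (hP : IsStochastic P) (n : ℕ) {g : State d → ℝ}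
    (hg : ∀ x, |g x| ≤ 1) (x : State d) :
    step (lastColumnTruncation P n) g x - step P g x ≤
      2 * step (lastColumnTruncation P n) (atLevel n) x := by
  have hgb : IsBdd g := ⟨1, hg⟩
  have hab := (isBdd_atLevel n).comp (capLevel (d := d) n)
  rw [step_lastColumnTruncation hP, step_lastColumnTruncation hP]
  simp only [step]
  rw [← (hP.row x).expect_sub (hgb.comp _) hgb, ← expect_const_mul]
  refine (hP.row x).expect_mono ((hgb.comp _).sub hgb) (hab.const_mul 2) fun y => ?_
  rcases lt_or_ge y.1 n with h | h
  · have hy : capLevel n y = y := by rw [capLevel, min_eq_left h.le]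
    rw [hy, sub_self, atLevel, if_neg h.ne, mul_zero]
  · have hy : atLevel n (capLevel n y) = 1 := by
      rw [atLevel, capLevel, if_pos (min_eq_right h)]
    rw [hy]
    linarith [(abs_le.1 (hg (capLevel n y))).2, (abs_le.1 (hg y)).1]

/-- After capping, being at level n means being at level at least n, and that indicator is
block-increasing. -/
theorem isBlockIncreasing_step_atLevel (hBM : IsBlockMonotone P) (n : ℕ) :
    IsBlockIncreasing (step (lastColumnTruncation P n) (atLevel n)) := by
  rw [step_lastColumnTruncation hBM.stochastic]
  refine hBM.preservesBlockIncreasing _ ((isBdd_atLevel n).comp _) fun k i => ?_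
  simp only [atLevel, capLevel, min_eq_right_iff]
  split_ifs
  exacts [le_rfl, by omega, zero_le_one, le_rfl]

/-- The discrepancy between `m` steps of the truncation and of the original chain is dominated by
a block-increasing function of mean `m ∑ᵢ ν(n, i)`. -/
theorem exists_iterate_step_sub_le (hBM : IsBlockMonotone P) {n : ℕ} {ν : State d → ℝ}
    (hν : IsStationary (lastColumnTruncation P n) ν) (m : ℕ) :
    ∃ W : State d → ℝ, IsBdd W ∧ IsBlockIncreasing W ∧ expect ν W = m * ∑ i, ν (n, i) ∧
      ∀ f : State d → ℝ, (∀ x, |f x| ≤ 1) → ∀ x,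
        ((step (lastColumnTruncation P n))^[m] f) x - ((step P)^[m] f) x ≤ 2 * W x := by
  have hP := hBM.stochastic
  have hQ := hP.lastColumnTruncation n
  induction m with
  | zero =>
    exact ⟨fun _ => 0, ⟨0, fun _ => by simp⟩, fun _ _ => le_rfl, by simp [expect],
      fun f _ x => by simp⟩
  | succ m ih =>
    obtain ⟨W, hWb, hWi, hWe, hW⟩ := ih
    have hTb := hQ.isBdd_step (isBdd_atLevel (d := d) n)
    have hQW := hQ.isBdd_step hWb
    -- Telescoping: Q^(m+1) f - P^(m+1) f = (Q - P) P^m f + Q (Q^m f - P^m f).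
    refine ⟨fun x => step (lastColumnTruncation P n) (atLevel n) x +
      step (lastColumnTruncation P n) W x, hTb.add hQW, fun k i => ?_, ?_, fun f hf x => ?_⟩
    · exact add_le_add (isBlockIncreasing_step_atLevel hBM n k i)
        (hBM.preservesBlockIncreasing_lastColumnTruncation n W hWb hWi k i)
    · rw [hν.isProbVec.expect_add hTb hQW, hν.expect_step hQ (isBdd_atLevel n),
        hν.expect_step hQ hWb, hWe, expect_atLevel]
      push_cast
      ring
    · have hPf := hP.abs_iterate_step_le hf m
      have hPb : IsBdd ((step P)^[m] f) := ⟨1, hPf⟩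
      have hQb : IsBdd ((step (lastColumnTruncation P n))^[m] f) :=
        ⟨1, hQ.abs_iterate_step_le hf m⟩
      have h1 := (hQ.row x).expect_mono (hQb.sub hPb) (hWb.const_mul 2) (hW f hf)
      rw [(hQ.row x).expect_sub hQb hPb, expect_const_mul] at h1
      have h2 := step_truncation_sub_le hP n hPf x
      rw [Function.iterate_succ_apply', Function.iterate_succ_apply']
      simp only [step] at h1 h2 ⊢
      linarith

end Truncation

end BlockMonotone

/-! ### The total variation bounds. -/

open BlockMonotone in
theorem tvNorm_stationary_truncation_sub_le {d : ℕ} {P : Matrix (State d) (State d) ℝ}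
    (hBM : IsBlockMonotone P) (hirr : P.IsIrreducible) {π v : State d → ℝ}
    (hπ : IsStationary P π) (hvBI : IsBlockIncreasing v) (hv1 : ∀ x, 1 ≤ v x) {γ b : ℝ}
    (hγ : γ ∈ Set.Ioo (0 : ℝ) 1) (hb : 0 ≤ b) (hdrift : GeometricDrift P v γ b) {n : ℕ}
    {πn : State d → ℝ} (hπn : IsStationary (lastColumnTruncation P n) πn) (m : ℕ) :
    tvNorm (πn - π) ≤
      4 * γ ^ m * (b / (1 - γ)) + 2 * (m : ℝ) * ∑ i : Fin d, πn (n, i) := by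
  have hP := hBM.stochastic
  have hQ := hP.lastColumnTruncation n
  have hpn := hπn.isProbVec
  obtain ⟨s, hs, heq⟩ := tvNorm_sub_eq hpn hπ.isProbVec
  obtain ⟨W, hWb, hWi, hWe, hW⟩ := exists_iterate_step_sub_le hBM hπn m
  have h1 := hπn.expect_sub_iterate_step_le hQ
    (hBM.preservesBlockIncreasing_lastColumnTruncation n) hv1 hγ hb
    (hdrift.lastColumnTruncation hP hvBI n) hs m
  -- Applied to -s, the one-sided estimate gives the lower bound for π(s).
  have h2 := hπ.expect_sub_iterate_step_le hP hBM.preservesBlockIncreasing hv1 hγ hb hdrift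
    (f := fun x => -s x) (fun x => by simpa using hs x) m
  simp only [iterate_step_neg, expect_neg] at h2
  have h3 := expect_phase_eq hBM hirr hπ hπn fun i => ((step P)^[m] s) (0, i)
  have hPb : IsBdd ((step P)^[m] s) := ⟨1, hP.abs_iterate_step_le hs m⟩
  have hQb : IsBdd ((step (lastColumnTruncation P n))^[m] s) :=
    ⟨1, hQ.abs_iterate_step_le hs m⟩
  -- Only the ν-mean of W is known, so W at level 0 is raised to W at the current level.
  have h4 := hpn.expect_mono ((hQb.comp fun x : State d => (0, x.2)).sub
    (hPb.comp fun x : State d => (0, x.2))) (hWb.const_mul 2) fun x =>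
      (hW s hs (0, x.2)).trans
        (mul_le_mul_of_nonneg_left (hWi.monotone x.2 (Nat.zero_le x.1)) zero_le_two)
  rw [hpn.expect_sub (hQb.comp _) (hPb.comp _), expect_const_mul, hWe] at h4
  rw [heq]
  linarith

theorem mainTheorem1 {d : ℕ}
    (P : Matrix (BlockMonotone.State d) (BlockMonotone.State d) ℝ)
    (hBM : BlockMonotone.IsBlockMonotone P)
    (hirr : P.IsIrreducible)
    (π : BlockMonotone.State d → ℝ) (hπ : BlockMonotone.IsStationary P π)
    (v : BlockMonotone.State d → ℝ)
    (hvBI : BlockMonotone.IsBlockIncreasing v) (hv1 : ∀ x, 1 ≤ v x)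
    (γ b : ℝ) (hγ : γ ∈ Set.Ioo (0 : ℝ) 1) (hb : 0 < b)
    (hdrift : BlockMonotone.GeometricDrift P v γ b)
    (n : ℕ) (hn : 1 ≤ n)
    (πn : BlockMonotone.State d → ℝ)
    (hπn : BlockMonotone.IsStationary (BlockMonotone.lastColumnTruncation P n) πn)
    (m : ℕ) (hm : 1 ≤ m) :
    BlockMonotone.tvNorm (πn - π) ≤
        4 * γ ^ m * (b / (1 - γ)) + 2 * (m : ℝ) * ∑ i : Fin d, πn (n, i) ∧
      BlockMonotone.tvNorm (πn - π) ≤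
        b / (1 - γ) * (4 * γ ^ m + 2 * (m : ℝ) * ∑ i : Fin d, 1 / v (n, i)) := by
  have h := tvNorm_stationary_truncation_sub_le hBM hirr hπ hvBI hv1 hγ hb.le hdrift hπn m
  refine ⟨h, h.trans ?_⟩
  have hv0 : ∀ x, 0 < v x := fun x => zero_lt_one.trans_le (hv1 x)
  obtain ⟨hs, hle⟩ := hπn.expect_le_of_drift (hBM.stochastic.lastColumnTruncation n)
    (fun x => (hv0 x).le) hγ hb.le (hdrift.lastColumnTruncation hBM.stochastic hvBI n)
  have hi : ∀ i, πn (n, i) ≤ b / (1 - γ) * (1 / v (n, i)) := fun i => by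
    rw [mul_one_div, le_div_iff₀ (hv0 _)]
    -- A single term of the series for πn(v) is at most the whole sum.
    exact (hs.le_tsum (n, i) fun x _ => mul_nonneg (hπn.nonneg x) (hv0 x).le).trans hle
  have hsum : ∑ i, πn (n, i) ≤ b / (1 - γ) * ∑ i, 1 / v (n, i) := by
    rw [Finset.mul_sum]
    exact Finset.sum_le_sum fun i _ => hi i
  calc _ ≤ 4 * γ ^ m * (b / (1 - γ)) + 2 * (m : ℝ) * (b / (1 - γ) * ∑ i, 1 / v (n, i)) := by
        gcongr
    _ = _ := by ring
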